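/- Let $A$ be a (real or complex, not necessarily unital) Banach algebra. Let $A^{op}$ be the Banach algebra obtained from $A$ by reversing the product, and let $A\widehat{\otimes}A^{op}$ be the projective tensor product, i.e. the completion of $A\otimes A^{op}$ in the norm $\|x\|=\inf\{\sum_i\|a_i\|\|b_i\| : x=\sum_i a_i\otimes b_i\}$ (finite sums), with the product determined by $(a\otimes b)(c\otimes d)=ac\otimes db$, where $db$ is the product in $A$. A Banach $B$-bimodule over a Banach algebra $B$ is a Banach space $X$ with a $B$-bimodule structure such that $\|b\cdot x\|\le C\|b\|\|x\|$ and $\|x\cdot b\|\le C\|b\|\|x\|$ for some constant $C>0$ and all $b\in B$, $x\in X$; its dual $X^*$ is a Banach $B$-bimodule via $\langle b\cdot f,x\rangle=\langle f,x\cdot b\rangle$ and $\langle f\cdot b,x\rangle=\langle f,b\cdot x\rangle$. The Banach algebra $B$ is amenable if for every Banach $B$-bimodule $X$ every continuous linear map $D:B\to X^*$ with $D(ab)=a\cdot D(b)+D(a)\cdot b$ for all $a,b\in B$ is of the form $D(a)=a\cdot f-f\cdot a$ for some $f\in X^*$. **Theorem.** Suppose that $A\widehat{\otimes}A^{op}$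 is amenable and that $A$ has a bounded approximate identity, i.e. a bounded net $(e_i)$ in $A$ with $ae_i\to a$ and $e_ia\to a$ in norm for every $a\in A$. Then $A$ is amenable. -/

import Mathlib

open scoped TensorProduct Topology

universe u v

noncomputable section

/-! ### The projective tensor product of two normed spaces -/

section ProjectiveNorm

variable {𝕜 : Type*} [RCLike 𝕜]
variable {E : Type*} [NormedAddCommGroup E] [NormedSpace 𝕜 E]
variable {F : Type*} [NormedAddCommGroup F] [NormedSpace 𝕜 F]

/-- The tensor `∑ xᵢ ⊗ yᵢ` represented by a finite list of pairs `(xᵢ, yᵢ)`. -/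
def tensorSum (𝕜 : Type*) [RCLike 𝕜] {E : Type*} [NormedAddCommGroup E] [NormedSpace 𝕜 E]
    {F : Type*} [NormedAddCommGroup F] [NormedSpace 𝕜 F] (l : List (E × F)) : E ⊗[𝕜] F :=
  (l.map fun p => p.1 ⊗ₜ[𝕜] p.2).sum

/-- The cost `∑ ‖xᵢ‖ ‖yᵢ‖` of a finite list of pairs `(xᵢ, yᵢ)`. -/
def tensorCost {E : Type*} [NormedAddCommGroup E] {F : Type*} [NormedAddCommGroup F]
    (l : List (E × F)) : ℝ :=
  (l.map fun p => ‖p.1‖ * ‖p.2‖).sum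

/-- The projective norm of `x ∈ E ⊗ F`: the infimum of `∑ ‖xᵢ‖ ‖yᵢ‖` over all finite
representations `x = ∑ xᵢ ⊗ yᵢ`. -/
def projectiveNorm (x : E ⊗[𝕜] F) : ℝ :=
  ⨅ l : {l : List (E × F) // tensorSum 𝕜 l = x}, tensorCost l.1

lemma tensorCost_nonneg (l : List (E × F)) : 0 ≤ tensorCost l := by
  refine List.sum_nonneg fun a ha => ?_
  obtain ⟨p, -, rfl⟩ := List.mem_map.1 ha
  positivity

lemma tensorSum_append (l m : List (E × F)) :
    tensorSum 𝕜 (l ++ m) = tensorSum 𝕜 l + tensorSum 𝕜 m := by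
  simp [tensorSum]

lemma tensorCost_append (l m : List (E × F)) :
    tensorCost (l ++ m) = tensorCost l + tensorCost m := by
  simp [tensorCost]

lemma tensorSum_smul (c : 𝕜) (l : List (E × F)) :
    tensorSum 𝕜 (l.map fun p => (c • p.1, p.2)) = c • tensorSum 𝕜 l := by
  induction l with
  | nil => simp [tensorSum]
  | cons a l ih =>
    simp only [tensorSum, List.map_cons, List.sum_cons, smul_add] at ih ⊢
    rw [ih, TensorProduct.smul_tmul']

lemma tensorCost_smul {𝕜 : Type*} [RCLike 𝕜] {E : Type*} [NormedAddCommGroup E] [NormedSpace 𝕜 E]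
    {F : Type*} [NormedAddCommGroup F] (c : 𝕜) (l : List (E × F)) :
    tensorCost (l.map fun p => (c • p.1, p.2)) = ‖c‖ * tensorCost l := by
  induction l with
  | nil => simp [tensorCost]
  | cons a l ih =>
    simp only [tensorCost, List.map_cons, List.sum_cons, mul_add, norm_smul] at ih ⊢
    rw [ih, mul_assoc]

lemma exists_tensorSum_eq (x : E ⊗[𝕜] F) : ∃ l : List (E × F), tensorSum 𝕜 l = x := by
  induction x using TensorProduct.induction_on with
  | zero => exact ⟨[], by simp [tensorSum]⟩
  | tmul a b => exact ⟨[(a, b)], by simp [tensorSum]⟩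
  | add x y hx hy =>
    obtain ⟨l, rfl⟩ := hx
    obtain ⟨m, rfl⟩ := hy
    exact ⟨l ++ m, tensorSum_append l m⟩

lemma projectiveNorm_nonneg (x : E ⊗[𝕜] F) : 0 ≤ projectiveNorm x :=
  Real.iInf_nonneg fun l => tensorCost_nonneg l.1

lemma projectiveNorm_le (l : List (E × F)) : projectiveNorm (tensorSum 𝕜 l) ≤ tensorCost l :=
  ciInf_le (f := fun m : {m : List (E × F) // tensorSum 𝕜 m = tensorSum 𝕜 l} => tensorCost m.1)
    ⟨0, by rintro _ ⟨m, rfl⟩; exact tensorCost_nonneg m.1⟩ ⟨l, rfl⟩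

lemma exists_tensorCost_lt (x : E ⊗[𝕜] F) {ε : ℝ} (hε : 0 < ε) :
    ∃ l : List (E × F), tensorSum 𝕜 l = x ∧ tensorCost l < projectiveNorm x + ε := by
  obtain ⟨l₀, h₀⟩ := exists_tensorSum_eq x
  have : Nonempty {l : List (E × F) // tensorSum 𝕜 l = x} := ⟨⟨l₀, h₀⟩⟩
  obtain ⟨l, hl⟩ := exists_lt_of_ciInf_lt
    (f := fun l : {l : List (E × F) // tensorSum 𝕜 l = x} => tensorCost l.1)
    (lt_add_of_pos_right (projectiveNorm x) hε)
  exact ⟨l.1, l.2, hl⟩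

lemma projectiveNorm_zero : projectiveNorm (0 : E ⊗[𝕜] F) = 0 :=
  le_antisymm (by simpa [tensorSum, tensorCost] using projectiveNorm_le (𝕜 := 𝕜) ([] : List (E × F)))
    (projectiveNorm_nonneg _)

lemma projectiveNorm_add_le (x y : E ⊗[𝕜] F) :
    projectiveNorm (x + y) ≤ projectiveNorm x + projectiveNorm y := by
  refine le_of_forall_pos_lt_add fun ε hε => ?_
  obtain ⟨l, rfl, hl⟩ := exists_tensorCost_lt x (half_pos hε)
  obtain ⟨m, rfl, hm⟩ := exists_tensorCost_lt y (half_pos hε)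
  have h := projectiveNorm_le (𝕜 := 𝕜) (l ++ m)
  rw [tensorSum_append, tensorCost_append] at h
  linarith

lemma projectiveNorm_smul_le (c : 𝕜) (x : E ⊗[𝕜] F) :
    projectiveNorm (c • x) ≤ ‖c‖ * projectiveNorm x := by
  refine le_of_forall_pos_le_add fun ε hε => ?_
  have hc : 0 < ‖c‖ + 1 := by positivity
  obtain ⟨l, rfl, hl⟩ := exists_tensorCost_lt x (div_pos hε hc)
  have h := projectiveNorm_le (𝕜 := 𝕜) (l.map fun p => (c • p.1, p.2))
  rw [tensorSum_smul, tensorCost_smul] at h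
  have h1 := mul_le_mul_of_nonneg_left hl.le (norm_nonneg c)
  have h2 : ‖c‖ * (ε / (‖c‖ + 1)) ≤ ε := by
    rw [mul_div_assoc', div_le_iff₀ hc]
    nlinarith [norm_nonneg c]
  rw [mul_add] at h1
  linarith

end ProjectiveNorm

section ProjectiveNormMul

variable {𝕜 : Type*} [RCLike 𝕜]
variable {A : Type*} [NonUnitalNormedRing A] [NormedSpace 𝕜 A] [IsScalarTower 𝕜 A A]
  [SMulCommClass 𝕜 A A]
variable {B : Type*} [NonUnitalNormedRing B] [NormedSpace 𝕜 B] [IsScalarTower 𝕜 B B]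
  [SMulCommClass 𝕜 B B]

lemma projectiveNorm_tensorSum_mul_le (l m : List (A × B)) :
    projectiveNorm (tensorSum 𝕜 l * tensorSum 𝕜 m) ≤ tensorCost l * tensorCost m := by
  induction l with
  | nil => simp [tensorSum, tensorCost, projectiveNorm_zero]
  | cons a l ih =>
    have ha : projectiveNorm (a.1 ⊗ₜ[𝕜] a.2 * tensorSum 𝕜 m) ≤ ‖a.1‖ * ‖a.2‖ * tensorCost m := by
      clear ih
      induction m with
      | nil => simp [tensorSum, tensorCost, projectiveNorm_zero]
      | cons b m ih =>
        have hb : projectiveNorm (a.1 ⊗ₜ[𝕜] a.2 * b.1 ⊗ₜ[𝕜] b.2)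
            ≤ ‖a.1‖ * ‖a.2‖ * (‖b.1‖ * ‖b.2‖) := by
          have h := projectiveNorm_le (𝕜 := 𝕜) [(a.1 * b.1, a.2 * b.2)]
          simp only [tensorSum, tensorCost, List.map_cons, List.map_nil, List.sum_cons,
            List.sum_nil, add_zero] at h
          rw [Algebra.TensorProduct.tmul_mul_tmul]
          refine h.trans ?_
          calc ‖a.1 * b.1‖ * ‖a.2 * b.2‖ ≤ (‖a.1‖ * ‖b.1‖) * (‖a.2‖ * ‖b.2‖) := by
                gcongr <;> exact norm_mul_le _ _
            _ = _ := by ring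
        have hs : tensorSum 𝕜 (b :: m) = b.1 ⊗ₜ[𝕜] b.2 + tensorSum 𝕜 m := by simp [tensorSum]
        have hc : tensorCost (b :: m) = ‖b.1‖ * ‖b.2‖ + tensorCost m := by simp [tensorCost]
        rw [hs, hc, mul_add, mul_add]
        exact (projectiveNorm_add_le _ _).trans (add_le_add hb ih)
    have hs : tensorSum 𝕜 (a :: l) = a.1 ⊗ₜ[𝕜] a.2 + tensorSum 𝕜 l := by simp [tensorSum]
    have hc : tensorCost (a :: l) = ‖a.1‖ * ‖a.2‖ + tensorCost l := by simp [tensorCost]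
    rw [hs, hc, add_mul, add_mul]
    exact (projectiveNorm_add_le _ _).trans (add_le_add ha ih)

lemma projectiveNorm_mul_le (x y : A ⊗[𝕜] B) :
    projectiveNorm (x * y) ≤ projectiveNorm x * projectiveNorm y := by
  have key : ∀ ε : ℝ, 0 < ε →
      projectiveNorm (x * y) ≤ (projectiveNorm x + ε) * (projectiveNorm y + ε) := by
    intro ε hε
    obtain ⟨l, hl, hl'⟩ := exists_tensorCost_lt x hε
    obtain ⟨m, hm, hm'⟩ := exists_tensorCost_lt y hε
    have h := projectiveNorm_tensorSum_mul_le (𝕜 := 𝕜) l m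
    rw [hl, hm] at h
    exact h.trans (mul_le_mul hl'.le hm'.le (tensorCost_nonneg m)
      (add_nonneg (projectiveNorm_nonneg x) hε.le))
  have ht : Filter.Tendsto (fun ε : ℝ => (projectiveNorm x + ε) * (projectiveNorm y + ε))
      (𝓝[>] 0) (𝓝 ((projectiveNorm x + 0) * (projectiveNorm y + 0))) := by
    refine Filter.Tendsto.mono_left ?_ nhdsWithin_le_nhds
    exact Continuous.tendsto (by fun_prop) 0
  rw [add_zero, add_zero] at ht
  exact ge_of_tendsto ht (Filter.eventually_of_mem self_mem_nhdsWithin fun ε hε => key ε hε)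

end ProjectiveNormMul

/-! ### The Banach algebra `A ⊗̂ B` -/

/-- The algebraic tensor product `A ⊗ B`, as a type that carries the projective norm. -/
def AlgTensor (𝕜 A B : Type*) [RCLike 𝕜] [NonUnitalNormedRing A] [NormedSpace 𝕜 A]
    [NonUnitalNormedRing B] [NormedSpace 𝕜 B] : Type _ :=
  A ⊗[𝕜] B

namespace AlgTensor

variable (𝕜 A B : Type*) [RCLike 𝕜]
variable [NonUnitalNormedRing A] [NormedSpace 𝕜 A] [IsScalarTower 𝕜 A A] [SMulCommClass 𝕜 A A]
variable [NonUnitalNormedRing B] [NormedSpace 𝕜 B] [IsScalarTower 𝕜 B B] [SMulCommClass 𝕜 B B]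

/-- The product on `A ⊗ B` is determined by `(a ⊗ b) (c ⊗ d) = ac ⊗ bd`. -/
instance : NonUnitalRing (AlgTensor 𝕜 A B) :=
  inferInstanceAs (NonUnitalRing (A ⊗[𝕜] B))

instance : Module 𝕜 (AlgTensor 𝕜 A B) :=
  inferInstanceAs (Module 𝕜 (A ⊗[𝕜] B))

instance : IsScalarTower 𝕜 (AlgTensor 𝕜 A B) (AlgTensor 𝕜 A B) :=
  inferInstanceAs (IsScalarTower 𝕜 (A ⊗[𝕜] B) (A ⊗[𝕜] B))

instance : SMulCommClass 𝕜 (AlgTensor 𝕜 A B) (AlgTensor 𝕜 A B) :=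
  inferInstanceAs (SMulCommClass 𝕜 (A ⊗[𝕜] B) (A ⊗[𝕜] B))

/-- The projective norm as a seminorm on `A ⊗ B`. -/
def seminorm : Seminorm 𝕜 (AlgTensor 𝕜 A B) :=
  Seminorm.ofSMulLE (fun x => projectiveNorm (𝕜 := 𝕜) (E := A) (F := B) x) projectiveNorm_zero
    projectiveNorm_add_le projectiveNorm_smul_le

instance : NonUnitalSeminormedRing (AlgTensor 𝕜 A B) :=
  { (inferInstance : NonUnitalRing (AlgTensor 𝕜 A B)),
    (seminorm 𝕜 A B).toAddGroupSeminorm.toSeminormedAddCommGroup with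
    norm_mul_le := projectiveNorm_mul_le }

instance : NormedSpace 𝕜 (AlgTensor 𝕜 A B) where
  norm_smul_le := projectiveNorm_smul_le

variable {𝕜 A B}

/-- The elementary tensor `a ⊗ b`. -/
def tmul (𝕜 : Type*) [RCLike 𝕜] {A B : Type*} [NonUnitalNormedRing A] [NormedSpace 𝕜 A]
    [NonUnitalNormedRing B] [NormedSpace 𝕜 B] (a : A) (b : B) : AlgTensor 𝕜 A B :=
  a ⊗ₜ[𝕜] b

lemma tmul_mul_tmul (a c : A) (b d : B) :
    tmul 𝕜 a b * tmul 𝕜 c d = tmul 𝕜 (a * c) (b * d) :=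
  Algebra.TensorProduct.tmul_mul_tmul a c b d

end AlgTensor

/-- The completion of a seminormed algebra that need not have a unit. -/
def AlgCompletion (R : Type*) [NonUnitalSeminormedRing R] : Type _ :=
  UniformSpace.Completion R

namespace AlgCompletion

open UniformSpace

variable {R : Type*} [NonUnitalSeminormedRing R]

instance : NormedAddCommGroup (AlgCompletion R) :=
  inferInstanceAs (NormedAddCommGroup (Completion R))

instance : CompleteSpace (AlgCompletion R) :=
  inferInstanceAs (CompleteSpace (Completion R))

/-- The canonical map from `R` to its completion. -/
def of : R →+ AlgCompletion R :=
  (Completion.toCompl : R →+ Completion R)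

lemma norm_of (x : R) : ‖of x‖ = ‖x‖ :=
  Completion.norm_coe x

lemma isDenseInducing_of : IsDenseInducing (of : R → AlgCompletion R) :=
  Completion.isDenseInducing_coe

lemma continuous_of : Continuous (of : R → AlgCompletion R) :=
  isDenseInducing_of.continuous

/-- The product on the completion: the continuous extension of the product on `R`. -/
instance : Mul (AlgCompletion R) :=
  ⟨fun x y => (isDenseInducing_of.prodMap isDenseInducing_of).extend
    (fun p : R × R => of (p.1 * p.2)) (x, y)⟩

lemma of_mul (x y : R) : of (x * y) = of x * of y :=
  ((isDenseInducing_of.prodMap isDenseInducing_of).extend_eq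
    (continuous_of.comp continuous_mul) (x, y)).symm

instance : ContinuousMul (AlgCompletion R) where
  continuous_mul := by
    let m := (AddMonoidHom.mul : R →+ R →+ R).compr₂ of
    have hm : Continuous fun p : R × R => m p.1 p.2 := continuous_of.comp continuous_mul
    exact (isDenseInducing_of.extend_Z_bilin isDenseInducing_of hm :)

@[elab_as_elim]
lemma induction {p : AlgCompletion R → Prop} (x : AlgCompletion R)
    (hp : IsClosed {x | p x}) (h : ∀ a : R, p (of a)) : p x :=
  isDenseInducing_of.dense.induction_on x hp h

lemma mul_assoc' (x y z : AlgCompletion R) : x * y * z = x * (y * z) := by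
  have hx : ∀ y z : AlgCompletion R, IsClosed {x : AlgCompletion R | x * y * z = x * (y * z)} :=
    fun y z => isClosed_eq ((continuous_id.mul continuous_const).mul continuous_const)
      (continuous_id.mul continuous_const)
  have hy : ∀ x z : AlgCompletion R, IsClosed {y : AlgCompletion R | x * y * z = x * (y * z)} :=
    fun x z => isClosed_eq ((continuous_const.mul continuous_id).mul continuous_const)
      (continuous_const.mul (continuous_id.mul continuous_const))
  have hz : ∀ x y : AlgCompletion R, IsClosed {z : AlgCompletion R | x * y * z = x * (y * z)} :=
    fun x y => isClosed_eq (continuous_const.mul continuous_id)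
      (continuous_const.mul (continuous_const.mul continuous_id))
  refine induction x (hx y z) fun a => ?_
  refine induction y (hy (of a) z) fun b => ?_
  refine induction z (hz (of a) (of b)) fun c => ?_
  rw [← of_mul, ← of_mul, ← of_mul, ← of_mul, mul_assoc]

lemma mul_add' (x y z : AlgCompletion R) : x * (y + z) = x * y + x * z := by
  have hx : ∀ y z : AlgCompletion R, IsClosed {x : AlgCompletion R | x * (y + z) = x * y + x * z} :=
    fun y z => isClosed_eq (continuous_id.mul continuous_const)
      ((continuous_id.mul continuous_const).add (continuous_id.mul continuous_const))
  have hy : ∀ x z : AlgCompletion R, IsClosed {y : AlgCompletion R | x * (y + z) = x * y + x * z} :=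
    fun x z => isClosed_eq (continuous_const.mul (continuous_id.add continuous_const))
      ((continuous_const.mul continuous_id).add continuous_const)
  have hz : ∀ x y : AlgCompletion R, IsClosed {z : AlgCompletion R | x * (y + z) = x * y + x * z} :=
    fun x y => isClosed_eq (continuous_const.mul (continuous_const.add continuous_id))
      (continuous_const.add (continuous_const.mul continuous_id))
  refine induction x (hx y z) fun a => ?_
  refine induction y (hy (of a) z) fun b => ?_
  refine induction z (hz (of a) (of b)) fun c => ?_
  rw [← map_add, ← of_mul, ← of_mul, ← of_mul, ← map_add, mul_add]

lemma add_mul' (x y z : AlgCompletion R) : (x + y) * z = x * z + y * z := by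
  have hx : ∀ y z : AlgCompletion R, IsClosed {x : AlgCompletion R | (x + y) * z = x * z + y * z} :=
    fun y z => isClosed_eq ((continuous_id.add continuous_const).mul continuous_const)
      ((continuous_id.mul continuous_const).add continuous_const)
  have hy : ∀ x z : AlgCompletion R, IsClosed {y : AlgCompletion R | (x + y) * z = x * z + y * z} :=
    fun x z => isClosed_eq ((continuous_const.add continuous_id).mul continuous_const)
      (continuous_const.add (continuous_id.mul continuous_const))
  have hz : ∀ x y : AlgCompletion R, IsClosed {z : AlgCompletion R | (x + y) * z = x * z + y * z} :=
    fun x y => isClosed_eq (continuous_const.mul continuous_id)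
      ((continuous_const.mul continuous_id).add (continuous_const.mul continuous_id))
  refine induction x (hx y z) fun a => ?_
  refine induction y (hy (of a) z) fun b => ?_
  refine induction z (hz (of a) (of b)) fun c => ?_
  rw [← map_add, ← of_mul, ← of_mul, ← of_mul, ← map_add, add_mul]

lemma norm_mul_le' (x y : AlgCompletion R) : ‖x * y‖ ≤ ‖x‖ * ‖y‖ := by
  have hx : ∀ y : AlgCompletion R, IsClosed {x : AlgCompletion R | ‖x * y‖ ≤ ‖x‖ * ‖y‖} :=
    fun y => isClosed_le (continuous_id.mul continuous_const).norm
      (continuous_norm.mul continuous_const)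
  have hy : ∀ x : AlgCompletion R, IsClosed {y : AlgCompletion R | ‖x * y‖ ≤ ‖x‖ * ‖y‖} :=
    fun x => isClosed_le (continuous_const.mul continuous_id).norm
      (continuous_const.mul continuous_norm)
  refine induction x (hx y) fun a => ?_
  refine induction y (hy (of a)) fun b => ?_
  rw [← of_mul, norm_of, norm_of, norm_of]
  exact norm_mul_le a b

instance : NonUnitalNormedRing (AlgCompletion R) :=
  { (inferInstance : NormedAddCommGroup (AlgCompletion R)),
    (inferInstance : Mul (AlgCompletion R)) with
    zero_mul := fun x => by
      have h := add_mul' (0 : AlgCompletion R) 0 x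
      rw [add_zero] at h
      exact left_eq_add.1 h
    mul_zero := fun x => by
      have h := mul_add' x (0 : AlgCompletion R) 0
      rw [add_zero] at h
      exact left_eq_add.1 h
    left_distrib := mul_add'
    right_distrib := add_mul'
    mul_assoc := mul_assoc'
    norm_mul_le := norm_mul_le' }

variable {𝕜 : Type*} [RCLike 𝕜] [NormedSpace 𝕜 R]

instance : NormedSpace 𝕜 (AlgCompletion R) :=
  inferInstanceAs (NormedSpace 𝕜 (Completion R))

lemma of_smul (c : 𝕜) (x : R) : of (c • x) = c • of x :=
  Completion.coe_smul c x

instance [IsScalarTower 𝕜 R R] : IsScalarTower 𝕜 (AlgCompletion R) (AlgCompletion R) where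
  smul_assoc c x y := by
    have hx : ∀ y : AlgCompletion R, IsClosed {x : AlgCompletion R | c • x * y = c • (x * y)} :=
      fun y => isClosed_eq ((continuous_const_smul c).mul continuous_const)
        ((continuous_id.mul continuous_const).const_smul c)
    have hy : ∀ x : AlgCompletion R, IsClosed {y : AlgCompletion R | c • x * y = c • (x * y)} :=
      fun x => isClosed_eq (continuous_const.mul continuous_id)
        ((continuous_const.mul continuous_id).const_smul c)
    change c • x * y = c • (x * y)
    refine induction x (hx y) fun a => ?_
    refine induction y (hy (of a)) fun b => ?_
    rw [← of_smul, ← of_mul, ← of_mul, ← of_smul, smul_mul_assoc]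

instance [SMulCommClass 𝕜 R R] : SMulCommClass 𝕜 (AlgCompletion R) (AlgCompletion R) where
  smul_comm c x y := by
    have hx : ∀ y : AlgCompletion R, IsClosed {x : AlgCompletion R | c • (x * y) = x * c • y} :=
      fun y => isClosed_eq ((continuous_id.mul continuous_const).const_smul c)
        (continuous_id.mul continuous_const)
    have hy : ∀ x : AlgCompletion R, IsClosed {y : AlgCompletion R | c • (x * y) = x * c • y} :=
      fun x => isClosed_eq ((continuous_const.mul continuous_id).const_smul c)
        (continuous_const.mul (continuous_const_smul c))
    change c • (x * y) = x * c • y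
    refine induction x (hx y) fun a => ?_
    refine induction y (hy (of a)) fun b => ?_
    rw [← of_smul, ← of_mul, ← of_mul, ← of_smul, mul_smul_comm]

end AlgCompletion

/-- The projective tensor product `A ⊗̂ B` of Banach algebras: the completion of `A ⊗ B` for the
projective norm. -/
abbrev ProjectiveTensor (𝕜 A B : Type*) [RCLike 𝕜]
    [NonUnitalNormedRing A] [NormedSpace 𝕜 A] [IsScalarTower 𝕜 A A] [SMulCommClass 𝕜 A A]
    [NonUnitalNormedRing B] [NormedSpace 𝕜 B] [IsScalarTower 𝕜 B B] [SMulCommClass 𝕜 B B] :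
    Type _ :=
  AlgCompletion (AlgTensor 𝕜 A B)

/-! ### Banach bimodules, derivations and amenability -/

section Amenability

/-- The structure of a Banach `A`-bimodule on a Banach space `X`: commuting left and right
actions `left a x = a · x` and `right a x = x · a`, bilinear and with
`‖a · x‖ ≤ C ‖a‖ ‖x‖` and `‖x · a‖ ≤ C ‖a‖ ‖x‖` for a constant `C`. The bounds are expressed by the
continuity of the linear maps involved. -/
structure BanachBimodule (𝕜 : Type*) [RCLike 𝕜] (A : Type*) [NonUnitalNormedRing A]
    [NormedSpace 𝕜 A] (X : Type*) [NormedAddCommGroup X] [NormedSpace 𝕜 X] where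
  left : A →L[𝕜] X →L[𝕜] X
  right : A →L[𝕜] X →L[𝕜] X
  left_mul : ∀ a b x, left (a * b) x = left a (left b x)
  right_mul : ∀ a b x, right (a * b) x = right b (right a x)
  left_right : ∀ a b x, right b (left a x) = left a (right b x)

namespace BanachBimodule

variable {𝕜 : Type*} [RCLike 𝕜] {A : Type*} [NonUnitalNormedRing A] [NormedSpace 𝕜 A]
  {X : Type*} [NormedAddCommGroup X] [NormedSpace 𝕜 X]

/-- The dual bimodule `X*`: `⟨a · f, x⟩ = ⟨f, x · a⟩` and `⟨f · a, x⟩ = ⟨f, a · x⟩`. -/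
def dual (M : BanachBimodule 𝕜 A X) : BanachBimodule 𝕜 A (StrongDual 𝕜 X) where
  left := (ContinuousLinearMap.compL 𝕜 X X 𝕜).flip ∘L M.right
  right := (ContinuousLinearMap.compL 𝕜 X X 𝕜).flip ∘L M.left
  left_mul a b f := by
    ext x
    simp [M.right_mul]
  right_mul a b f := by
    ext x
    simp [M.left_mul]
  left_right a b f := by
    ext x
    simp [M.left_right]

lemma dual_left_apply (M : BanachBimodule 𝕜 A X) (a : A) (f : StrongDual 𝕜 X) (x : X) :
    M.dual.left a f x = f (M.right a x) := rfl

lemma dual_right_apply (M : BanachBimodule 𝕜 A X) (a : A) (f : StrongDual 𝕜 X) (x : X) :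
    M.dual.right a f x = f (M.left a x) := rfl

/-- `D(ab) = a · D(b) + D(a) · b`. -/
def IsDerivation (M : BanachBimodule 𝕜 A X) (D : A →L[𝕜] X) : Prop :=
  ∀ a b, D (a * b) = M.left a (D b) + M.right b (D a)

/-- There is an `x` with `D(a) = a · x - x · a` for all `a`. -/
def IsInner (M : BanachBimodule 𝕜 A X) (D : A →L[𝕜] X) : Prop :=
  ∃ x, ∀ a, D a = M.left a x - M.right a x

end BanachBimodule

/-- `A` is amenable: for every Banach `A`-bimodule `X` (in the universe `v`), every continuous
derivation from `A` into the dual bimodule `X*` is inner. -/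
def IsAmenable (𝕜 : Type) [RCLike 𝕜] (A : Type u) [NonUnitalNormedRing A] [NormedSpace 𝕜 A] :
    Prop :=
  ∀ (X : Type v) [NormedAddCommGroup X] [NormedSpace 𝕜 X] [CompleteSpace X]
    (M : BanachBimodule 𝕜 A X) (D : A →L[𝕜] StrongDual 𝕜 X),
    M.dual.IsDerivation D → M.dual.IsInner D

/-- `A` has a bounded (two-sided) approximate identity. The net is given by a proper filter `l`
along which `a * e → a` and `e * a → a` for every `a`, and along which `e` is bounded. -/
def HasBoundedApproximateIdentity (A : Type*) [NonUnitalNormedRing A] : Prop :=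
  ∃ l : Filter A, l.IsApproximateUnit ∧ ∃ C : ℝ, ∀ᶠ e in l, ‖e‖ ≤ C

end Amenability

end

open Filter

noncomputable section


/-! ### Weak-star limits -/

/-! Write `B = A ⊗̂ Aᵒᵖ`, acting on `A` by `(c ⊗ d) · a = cad`. The product map `π : B → A` is then
a map of left `B`-modules, and the heart of the proof is that it splits after passing to second
duals: there is a bounded `B`-module map `G : A → B**` with `π**(G a) = a`
(`Enveloping.exists_module_splitting`).

To find `G`, let `Y` be the `B`-bimodule of operators `A → B`. The operators `a ↦ a ⊗ e`, with `e`
running along the approximate identity, have a weak-star limit `q` in `Y**`. It inverts `π` on the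
right, but need not commute with `B`. The commutator of `q` with `B` is a derivation, and it
vanishes on the functionals `T ↦ f(π(T a))`, so its values lie in the dual of a quotient of `Y*`.
Amenability of `B` makes it inner there; subtracting the implementing functional makes `q` central
without changing its values on those functionals (`IsAmenable.exists_central_extension`).

The elements `G e` then act as an approximate diagonal. For a derivation `D : A → X*`, let `f` be
the weak-star limit of the images of `G e` under `c ⊗ d ↦ c · D(d)`. The module property and the
Leibniz rule give `e · D(a) → a · f - f · a` weak-star (`Enveloping.exists_approximately_inner`).
Hence `D` minus the inner derivation of `f` is killed by the left action of `A`, and such a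
derivation is inner by a second weak-star limit (`BanachBimodule.isInner_of_tendsto`). -/

lemma exists_weakStar_limit {𝕜 : Type*} [RCLike 𝕜] {ι X : Type*} [NormedAddCommGroup X]
    [NormedSpace 𝕜 X] (U : Ultrafilter ι) (T : ι → StrongDual 𝕜 X) (C : ℝ)
    (hT : ∀ᶠ i in (U : Filter ι), ‖T i‖ ≤ C) :
    ∃ f : StrongDual 𝕜 X, ∀ x, Tendsto (fun i => T i x) U (𝓝 (f x)) := by
  -- Banach–Alaoglu: an ultrafilter living on a weak-star compact ball converges, so no subnet has
  -- to be chosen.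
  have hK := WeakDual.isCompact_closedBall (𝕜 := 𝕜) (0 : StrongDual 𝕜 X) C
  obtain ⟨f, -, hf⟩ := hK.ultrafilter_le_nhds
    (U.map fun i => StrongDual.toWeakDual (T i)) (by
      rw [le_principal_iff]
      change ∀ᶠ i in (U : Filter ι), T i ∈ Metric.closedBall 0 C
      filter_upwards [hT] with i hi
      rwa [mem_closedBall_zero_iff])
  refine ⟨WeakDual.toStrongDual f, fun x => ?_⟩
  exact ((WeakDual.eval_continuous x).tendsto f).comp hf

/-! ### Universal property of the projective tensor product -/

namespace ProjectiveTensor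

variable {𝕜 A B G : Type*} [RCLike 𝕜]
variable [NonUnitalNormedRing A] [NormedSpace 𝕜 A] [IsScalarTower 𝕜 A A] [SMulCommClass 𝕜 A A]
variable [NonUnitalNormedRing B] [NormedSpace 𝕜 B] [IsScalarTower 𝕜 B B] [SMulCommClass 𝕜 B B]
variable [NormedAddCommGroup G] [NormedSpace 𝕜 G]

/-- The canonical map from the algebraic tensor product to its completion. -/
def ofLinear (𝕜 A B : Type*) [RCLike 𝕜] [NonUnitalNormedRing A] [NormedSpace 𝕜 A]
    [IsScalarTower 𝕜 A A] [SMulCommClass 𝕜 A A] [NonUnitalNormedRing B] [NormedSpace 𝕜 B]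
    [IsScalarTower 𝕜 B B] [SMulCommClass 𝕜 B B] :
    AlgTensor 𝕜 A B →ₗ[𝕜] ProjectiveTensor 𝕜 A B where
  toFun := AlgCompletion.of
  map_add' := map_add _
  map_smul' := AlgCompletion.of_smul

lemma norm_ofLinear (x : AlgTensor 𝕜 A B) : ‖ofLinear 𝕜 A B x‖ = ‖x‖ :=
  AlgCompletion.norm_of x

lemma denseRange_ofLinear : DenseRange (ofLinear 𝕜 A B) :=
  AlgCompletion.isDenseInducing_of.dense

lemma norm_algTensor_tmul_le (a : A) (b : B) : ‖AlgTensor.tmul 𝕜 a b‖ ≤ ‖a‖ * ‖b‖ := by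
  have h := projectiveNorm_le (𝕜 := 𝕜) [(a, b)]
  simp only [tensorSum, tensorCost, List.map_cons, List.map_nil, List.sum_cons, List.sum_nil,
    add_zero] at h
  exact h

/-- The elementary tensor `a ⊗ b` as a continuous bilinear map into the completion. -/
def tmul (𝕜 A B : Type*) [RCLike 𝕜] [NonUnitalNormedRing A] [NormedSpace 𝕜 A]
    [IsScalarTower 𝕜 A A] [SMulCommClass 𝕜 A A] [NonUnitalNormedRing B] [NormedSpace 𝕜 B]
    [IsScalarTower 𝕜 B B] [SMulCommClass 𝕜 B B] : A →L[𝕜] B →L[𝕜] ProjectiveTensor 𝕜 A B :=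
  LinearMap.mkContinuous₂
    ((TensorProduct.mk 𝕜 A B).compr₂ (ofLinear 𝕜 A B : A ⊗[𝕜] B →ₗ[𝕜] ProjectiveTensor 𝕜 A B)) 1
    fun a b => by
      rw [one_mul]
      exact (norm_ofLinear (𝕜 := 𝕜) (AlgTensor.tmul 𝕜 a b)).trans_le (norm_algTensor_tmul_le a b)

lemma tmul_apply (a : A) (b : B) :
    tmul 𝕜 A B a b = ofLinear 𝕜 A B (AlgTensor.tmul 𝕜 a b) := rfl

lemma tmul_mul_tmul (a c : A) (b d : B) :
    tmul 𝕜 A B a b * tmul 𝕜 A B c d = tmul 𝕜 A B (a * c) (b * d) := by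
  rw [tmul_apply, tmul_apply, tmul_apply, ← AlgTensor.tmul_mul_tmul]
  exact (AlgCompletion.of_mul _ _).symm

lemma induction_tmul {p : ProjectiveTensor 𝕜 A B → Prop} (x : ProjectiveTensor 𝕜 A B)
    (hp : IsClosed {x | p x}) (tmul : ∀ a b, p (tmul 𝕜 A B a b))
    (add : ∀ x y, p x → p y → p (x + y)) : p x := by
  refine AlgCompletion.induction x hp fun t => ?_
  change p (ofLinear 𝕜 A B t)
  refine TensorProduct.induction_on (motive := fun t => p (ofLinear 𝕜 A B t)) t ?_ tmul ?_
  · have h := tmul 0 0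
    rw [map_zero] at h
    rwa [show ofLinear 𝕜 A B (0 : A ⊗[𝕜] B) = 0 from map_zero _]
  · intro s t hs ht
    rw [show ofLinear 𝕜 A B (s + t : A ⊗[𝕜] B) = ofLinear 𝕜 A B s + ofLinear 𝕜 A B t from
      map_add (ofLinear 𝕜 A B) s t]
    exact add _ _ hs ht

lemma hom_ext {f g : ProjectiveTensor 𝕜 A B →L[𝕜] G}
    (h : ∀ a b, f (tmul 𝕜 A B a b) = g (tmul 𝕜 A B a b)) : f = g := by
  ext x
  exact induction_tmul x (isClosed_eq f.continuous g.continuous) h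
    fun x y hx hy => by rw [map_add, map_add, hx, hy]

/-- The linear map on the algebraic tensor product induced by a continuous bilinear map. -/
def algLift (T : A →L[𝕜] B →L[𝕜] G) : AlgTensor 𝕜 A B →ₗ[𝕜] G :=
  (TensorProduct.lift ((ContinuousLinearMap.coeLM 𝕜).comp (T : A →ₗ[𝕜] B →L[𝕜] G)) :
    A ⊗[𝕜] B →ₗ[𝕜] G)

lemma algLift_tmul (T : A →L[𝕜] B →L[𝕜] G) (a : A) (b : B) :
    algLift T (AlgTensor.tmul 𝕜 a b) = T a b :=
  TensorProduct.lift.tmul _ _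

lemma norm_algLift_tensorSum_le (T : A →L[𝕜] B →L[𝕜] G) (l : List (A × B)) :
    ‖algLift T (tensorSum 𝕜 l : A ⊗[𝕜] B)‖ ≤ ‖T‖ * tensorCost l := by
  induction l with
  | nil =>
    have h : algLift T (0 : AlgTensor 𝕜 A B) = 0 := map_zero _
    simp only [tensorSum, tensorCost, List.map_nil, List.sum_nil, mul_zero]
    exact (norm_eq_zero.2 h).le
  | cons p l ih =>
    have h : algLift T (tensorSum 𝕜 (p :: l) : A ⊗[𝕜] B)
        = T p.1 p.2 + algLift T (tensorSum 𝕜 l : A ⊗[𝕜] B) := by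
      rw [← algLift_tmul T]
      exact map_add (algLift T) _ _
    have hc : tensorCost (p :: l) = ‖p.1‖ * ‖p.2‖ + tensorCost l := by simp [tensorCost]
    rw [h, hc, mul_add, ← mul_assoc]
    exact (norm_add_le _ _).trans (add_le_add (T.le_opNorm₂ _ _) ih)

/-- Every representation of `x` bounds the image by `‖T‖` times its cost, and the projective norm is
the infimum of the costs. This bound is what lets the map extend to the completion. -/
lemma norm_algLift_le (T : A →L[𝕜] B →L[𝕜] G) (x : AlgTensor 𝕜 A B) :
    ‖algLift T x‖ ≤ ‖T‖ * ‖x‖ := by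
  have key : ∀ ε : ℝ, 0 < ε → ‖algLift T x‖ ≤ ‖T‖ * (‖x‖ + ε) := by
    intro ε hε
    obtain ⟨l, hl, hl'⟩ := exists_tensorCost_lt (𝕜 := 𝕜) (E := A) (F := B) x hε
    have h := norm_algLift_tensorSum_le T l
    rw [hl] at h
    exact h.trans (mul_le_mul_of_nonneg_left hl'.le (norm_nonneg T))
  have ht : Tendsto (fun ε : ℝ => ‖T‖ * (‖x‖ + ε)) (𝓝[>] 0) (𝓝 (‖T‖ * (‖x‖ + 0))) :=
    (Continuous.tendsto (by fun_prop) 0).mono_left nhdsWithin_le_nhds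
  rw [add_zero] at ht
  exact ge_of_tendsto ht (eventually_of_mem self_mem_nhdsWithin key)

variable [CompleteSpace G]

/-- The continuous linear map on `A ⊗̂ B` induced by a continuous bilinear map. -/
def lift (T : A →L[𝕜] B →L[𝕜] G) : ProjectiveTensor 𝕜 A B →L[𝕜] G :=
  (algLift T).extendOfNorm (ofLinear 𝕜 A B)

lemma lift_tmul (T : A →L[𝕜] B →L[𝕜] G) (a : A) (b : B) : lift T (tmul 𝕜 A B a b) = T a b := by
  have hT : ∃ C, ∀ x, ‖algLift T x‖ ≤ C * ‖ofLinear 𝕜 A B x‖ :=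
    ⟨‖T‖, fun x => (norm_algLift_le T x).trans_eq (by rw [norm_ofLinear])⟩
  rw [tmul_apply, ← algLift_tmul T, lift]
  have h := LinearMap.extendOfNorm_eq (f := algLift T) (e := ofLinear 𝕜 A B) denseRange_ofLinear
  exact h hT _

end ProjectiveTensor

/-! ### Central extension of functionals over an amenable algebra -/

section CentralExtension

variable {𝕜 : Type*} [RCLike 𝕜]

/-- A continuous family of operators that vanish on `N`, as a family of operators on `Y ⧸ N`. -/
def quotientLift {V Y G : Type*} [NormedAddCommGroup V] [NormedSpace 𝕜 V] [NormedAddCommGroup Y]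
    [NormedSpace 𝕜 Y] [NormedAddCommGroup G] [NormedSpace 𝕜 G] (N : Submodule 𝕜 Y)
    [IsClosed (N : Set Y)]
    (F : V →L[𝕜] Y →L[𝕜] G) (hF : ∀ v, N ≤ (F v).ker) : V →L[𝕜] (Y ⧸ N) →L[𝕜] G :=
  LinearMap.mkContinuous
    { toFun := fun v => N.liftQL (F v) (hF v)
      map_add' := fun v w => by
        ext y
        obtain ⟨y, rfl⟩ := N.mkQ_surjective y
        change F (v + w) y = F v y + F w y
        simp
      map_smul' := fun c v => by
        ext y
        obtain ⟨y, rfl⟩ := N.mkQ_surjective y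
        change F (c • v) y = c • F v y
        simp } ‖F‖ fun v => by
    refine ContinuousLinearMap.opNorm_le_bound _ (by positivity) fun y => ?_
    refine le_of_forall_pos_le_add fun ε hε => ?_
    -- The summand `1` keeps the divisor positive when `F` or `v` is zero.
    have hc : 0 < ‖F‖ * ‖v‖ + 1 := by positivity
    obtain ⟨y, rfl, hy⟩ := Submodule.Quotient.norm_mk_lt y (div_pos hε hc)
    change ‖F v y‖ ≤ _
    have h1 : ‖F v y‖ ≤ ‖F‖ * ‖v‖ * ‖y‖ := F.le_opNorm₂ v y
    have h2 := mul_le_mul_of_nonneg_left hy.le (by positivity : 0 ≤ ‖F‖ * ‖v‖)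
    have h3 : ‖F‖ * ‖v‖ * (ε / (‖F‖ * ‖v‖ + 1)) ≤ ε := by
      rw [mul_div_assoc', div_le_iff₀ hc]
      nlinarith
    rw [mul_add] at h2
    linarith

lemma quotientLift_mk {V Y G : Type*} [NormedAddCommGroup V] [NormedSpace 𝕜 V]
    [NormedAddCommGroup Y] [NormedSpace 𝕜 Y] [NormedAddCommGroup G] [NormedSpace 𝕜 G]
    (N : Submodule 𝕜 Y) [IsClosed (N : Set Y)]
    (F : V →L[𝕜] Y →L[𝕜] G) (hF : ∀ v, N ≤ (F v).ker) (v : V) (y : Y) :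
    quotientLift N F hF v (N.mkQL y) = F v y := rfl

/-- The quotient of a Banach bimodule by a closed sub-bimodule. -/
def BanachBimodule.quotient {A Y : Type*} [NonUnitalNormedRing A] [NormedSpace 𝕜 A]
    [NormedAddCommGroup Y] [NormedSpace 𝕜 Y] (M : BanachBimodule 𝕜 A Y) (N : Submodule 𝕜 Y)
    [IsClosed (N : Set Y)] (hl : ∀ a, ∀ y ∈ N, M.left a y ∈ N)
    (hr : ∀ a, ∀ y ∈ N, M.right a y ∈ N) : BanachBimodule 𝕜 A (Y ⧸ N) where
  left := quotientLift N (ContinuousLinearMap.compL 𝕜 Y Y (Y ⧸ N) N.mkQL ∘L M.left)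
    fun a y hy => (Submodule.Quotient.mk_eq_zero N).2 (hl a y hy)
  right := quotientLift N (ContinuousLinearMap.compL 𝕜 Y Y (Y ⧸ N) N.mkQL ∘L M.right)
    fun a y hy => (Submodule.Quotient.mk_eq_zero N).2 (hr a y hy)
  left_mul a b y := by
    obtain ⟨y, rfl⟩ := N.mkQ_surjective y
    exact congrArg N.mkQL (M.left_mul a b y)
  right_mul a b y := by
    obtain ⟨y, rfl⟩ := N.mkQ_surjective y
    exact congrArg N.mkQL (M.right_mul a b y)
  left_right a b y := by
    obtain ⟨y, rfl⟩ := N.mkQ_surjective y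
    exact congrArg N.mkQL (M.left_right a b y)

/-- A functional on a Banach bimodule over an amenable algebra that is central on an invariant
set `S` agrees on `S` with a functional that is central everywhere. -/
theorem IsAmenable.exists_central_extension {𝕜 : Type} [RCLike 𝕜] {A : Type u}
    [NonUnitalNormedRing A] [NormedSpace 𝕜 A] (hA : IsAmenable.{u, v} 𝕜 A) {Y : Type v}
    [NormedAddCommGroup Y] [NormedSpace 𝕜 Y] [CompleteSpace Y] (M : BanachBimodule 𝕜 A Y)
    (S : Set Y) (hl : ∀ a, ∀ y ∈ S, M.left a y ∈ S) (hr : ∀ a, ∀ y ∈ S, M.right a y ∈ S)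
    (q : StrongDual 𝕜 Y) (hq : ∀ a, ∀ y ∈ S, q (M.right a y) = q (M.left a y)) :
    ∃ p : StrongDual 𝕜 Y, (∀ y ∈ S, p y = q y) ∧ ∀ a y, p (M.right a y) = p (M.left a y) := by
  -- The closure makes `Y ⧸ N` a Banach space; invariance and centrality pass from `S` to `N` by
  -- linearity and continuity.
  let N : Submodule 𝕜 Y := (Submodule.span 𝕜 S).topologicalClosure
  have hN : IsClosed (N : Set Y) := Submodule.isClosed_topologicalClosure _
  have hS : S ⊆ N := Submodule.subset_span.trans (Submodule.le_topologicalClosure _)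
  have hN_map : ∀ f : Y →L[𝕜] Y, (∀ y ∈ S, f y ∈ S) → ∀ y ∈ N, f y ∈ N := fun f hf =>
    Submodule.topologicalClosure_minimal (t := N.comap (f : Y →ₗ[𝕜] Y)) _
      (Submodule.span_le.2 fun y hy => hS (hf y hy)) (hN.preimage f.continuous)
  have hNl : ∀ a, ∀ y ∈ N, M.left a y ∈ N := fun a => hN_map _ (hl a)
  have hNr : ∀ a, ∀ y ∈ N, M.right a y ∈ N := fun a => hN_map _ (hr a)
  have hNq : ∀ a, N ≤ ((ContinuousLinearMap.compL 𝕜 Y Y 𝕜 q ∘L (M.right - M.left)) a).ker := by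
    intro a
    refine Submodule.topologicalClosure_minimal _ (Submodule.span_le.2 fun y hy => ?_)
      (ContinuousLinearMap.isClosed_ker _)
    simp [hq a y hy]
  -- The commutator of `q` with the algebra. It vanishes on `N`, so it is a map into the dual of `Y
  -- ⧸ N`.
  let D := quotientLift N (ContinuousLinearMap.compL 𝕜 Y Y 𝕜 q ∘L (M.right - M.left)) hNq
  have hD : ∀ a y, D a (N.mkQL y) = q (M.right a y) - q (M.left a y) := fun a y => by
    simp only [D, quotientLift_mk]
    simp
  obtain ⟨f, hf⟩ := hA (Y ⧸ N) (M.quotient N hNl hNr) D (by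
    intro a b
    ext y
    obtain ⟨y, rfl⟩ := N.mkQ_surjective y
    -- In the sum on the right the mixed terms `q(b · y · a)` cancel, because the two actions
    -- commute.
    change D (a * b) (N.mkQL y) = D b (N.mkQL (M.right a y)) + D a (N.mkQL (M.left b y))
    rw [hD, hD, hD, M.right_mul, M.left_mul, M.left_right]
    ring)
  -- The pullback of `f` has the same commutator as `q` and is zero on `S`.
  refine ⟨q - f ∘L N.mkQL, fun y hy => ?_, fun a y => ?_⟩
  · have : N.mkQL y = 0 := (Submodule.Quotient.mk_eq_zero N).2 (hS hy)
    simp only [sub_apply, ContinuousLinearMap.comp_apply, this, map_zero,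
      sub_zero]
  · have h1 : D a (N.mkQL y) = f (N.mkQL (M.right a y)) - f (N.mkQL (M.left a y)) :=
      congrArg (fun g : StrongDual 𝕜 (Y ⧸ N) => g (N.mkQL y)) (hf a)
    rw [hD] at h1
    simp only [sub_apply, ContinuousLinearMap.comp_apply]
    linear_combination h1

end CentralExtension


/-! ### Approximate identities along an ultrafilter -/

lemma HasBoundedApproximateIdentity.exists_ultrafilter {A : Type*} [NonUnitalNormedRing A]
    (h : HasBoundedApproximateIdentity A) :
    ∃ U : Ultrafilter A, (U : Filter A).IsApproximateUnit ∧ ∃ C : ℝ, ∀ᶠ e in (U : Filter A),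
      ‖e‖ ≤ C := by
  obtain ⟨l, hl, C, hC⟩ := h
  have := hl.neBot
  have hU : (Ultrafilter.of l : Filter A) ≤ l := Ultrafilter.of_le l
  exact ⟨Ultrafilter.of l, ⟨fun a => (hl.tendsto_mul_left a).mono_left hU,
    fun a => (hl.tendsto_mul_right a).mono_left hU⟩, C, hC.filter_mono hU⟩

/-- Boundedness gives `e(ae - a) → 0`. Thus `a` is the limit of `(e ⊗ e) · a`, and continuous
identities in `a` can be tested on elements of this form without factorizing `a`. -/
lemma Filter.IsApproximateUnit.tendsto_mul_mul {A : Type*} [NonUnitalNormedRing A] {l : Filter A}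
    (hl : l.IsApproximateUnit) {C : ℝ} (hC : ∀ᶠ e in l, ‖e‖ ≤ C) (a : A) :
    Tendsto (fun e => e * (a * e)) l (𝓝 a) := by
  have h0 : Tendsto (fun e => e * (a * e - a)) l (𝓝 0) := by
    have h1 : Tendsto (fun e => C * ‖a * e - a‖) l (𝓝 0) := by
      simpa using ((hl.tendsto_mul_left a).sub_const a).norm.const_mul C
    refine squeeze_zero_norm' ?_ h1
    filter_upwards [hC] with e he
    exact (norm_mul_le _ _).trans (mul_le_mul_of_nonneg_right he (norm_nonneg _))
  simpa [mul_sub] using h0.add (hl.tendsto_mul_right a)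

lemma ContinuousLinearMap.exists_weakStar_limit {𝕜 : Type*} [RCLike 𝕜] {A X : Type*}
    [NormedAddCommGroup A] [NormedSpace 𝕜 A] [NormedAddCommGroup X] [NormedSpace 𝕜 X]
    (T : A →L[𝕜] StrongDual 𝕜 X) {U : Ultrafilter A} {C : ℝ}
    (hC : ∀ᶠ e in (U : Filter A), ‖e‖ ≤ C) :
    ∃ f : StrongDual 𝕜 X, ∀ x, Tendsto (fun e => T e x) U (𝓝 (f x)) :=
  _root_.exists_weakStar_limit U T (‖T‖ * C) <| hC.mono fun e he =>
    (T.le_opNorm e).trans (mul_le_mul_of_nonneg_left he (norm_nonneg _))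

/-! ### The enveloping algebra `A ⊗̂ Aᵒᵖ` -/

namespace Enveloping

open MulOpposite

variable (𝕜 A : Type*) [RCLike 𝕜] [NonUnitalNormedRing A] [NormedSpace 𝕜 A] [IsScalarTower 𝕜 A A]
  [SMulCommClass 𝕜 A A]

/-- The map `Aᵒᵖ → A` forgetting the reversal of the product. -/
def unopL : Aᵐᵒᵖ →L[𝕜] A := ((opContinuousLinearEquiv 𝕜).symm : Aᵐᵒᵖ ≃L[𝕜] A)

/-- The tensor `a ⊗ e` as a function of `e`, with values in the operators `A → A ⊗̂ Aᵒᵖ`. -/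
def tensorRight : A →L[𝕜] A →L[𝕜] ProjectiveTensor 𝕜 A Aᵐᵒᵖ :=
  (ProjectiveTensor.tmul 𝕜 A Aᵐᵒᵖ).flip ∘L ((opContinuousLinearEquiv 𝕜 : A ≃L[𝕜] Aᵐᵒᵖ) : A →L[𝕜] Aᵐᵒᵖ)

variable {𝕜 A}

lemma tensorRight_apply (e a : A) :
    tensorRight 𝕜 A e a = ProjectiveTensor.tmul 𝕜 A Aᵐᵒᵖ a (op e) := rfl

lemma hom_ext {G : Type*} [NormedAddCommGroup G] [NormedSpace 𝕜 G]
    {f g : ProjectiveTensor 𝕜 A Aᵐᵒᵖ →L[𝕜] G}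
    (h : ∀ a b : A, f (ProjectiveTensor.tmul 𝕜 A Aᵐᵒᵖ a (op b))
      = g (ProjectiveTensor.tmul 𝕜 A Aᵐᵒᵖ a (op b))) : f = g :=
  ProjectiveTensor.hom_ext fun a b => h a b.unop

lemma tmul_mul_tmul (a b c d : A) :
    ProjectiveTensor.tmul 𝕜 A Aᵐᵒᵖ a (op b) * ProjectiveTensor.tmul 𝕜 A Aᵐᵒᵖ c (op d)
      = ProjectiveTensor.tmul 𝕜 A Aᵐᵒᵖ (a * c) (op (d * b)) :=
  ProjectiveTensor.tmul_mul_tmul _ _ _ _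

/-! ### The operator induced by a derivation. -/

variable {X : Type*} [NormedAddCommGroup X] [NormedSpace 𝕜 X]

/-- The map `A ⊗̂ Aᵒᵖ → X*`, `c ⊗ d ↦ c · D(d)`, induced by an operator `D : A → X*`. -/
def derivationMap (M : BanachBimodule 𝕜 A X) (D : A →L[𝕜] StrongDual 𝕜 X) :
    ProjectiveTensor 𝕜 A Aᵐᵒᵖ →L[𝕜] StrongDual 𝕜 X :=
  ProjectiveTensor.lift (M.dual.left.bilinearComp (.id 𝕜 A) (D ∘L unopL 𝕜 A))

lemma derivationMap_tmul (M : BanachBimodule 𝕜 A X) (D : A →L[𝕜] StrongDual 𝕜 X) (c d : A)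
    (x : X) : derivationMap M D (ProjectiveTensor.tmul 𝕜 A Aᵐᵒᵖ c (op d)) x
      = D d (M.right c x) := by
  rw [derivationMap, ProjectiveTensor.lift_tmul]
  rfl

/-! ### `A` as a left module over its enveloping algebra. -/

variable [CompleteSpace A]

variable (𝕜 A) in
/-- The action of `A ⊗̂ Aᵒᵖ` on `A` given by `(c ⊗ d) · a = cad`. -/
def action : ProjectiveTensor 𝕜 A Aᵐᵒᵖ →L[𝕜] A →L[𝕜] A :=
  ProjectiveTensor.lift ((ContinuousLinearMap.compL 𝕜 A A A).bilinearComp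
    (ContinuousLinearMap.mul 𝕜 A) ((ContinuousLinearMap.mul 𝕜 A).flip ∘L unopL 𝕜 A))

lemma action_tmul (c d a : A) :
    action 𝕜 A (ProjectiveTensor.tmul 𝕜 A Aᵐᵒᵖ c (op d)) a = c * (a * d) := by
  rw [action, ProjectiveTensor.lift_tmul]
  rfl

lemma action_mul (b b' : ProjectiveTensor 𝕜 A Aᵐᵒᵖ) (a : A) :
    action 𝕜 A (b * b') a = action 𝕜 A b (action 𝕜 A b' a) := by
  have h : ContinuousLinearMap.compL 𝕜 _ _ _ (action 𝕜 A)
        ∘L ContinuousLinearMap.mul 𝕜 (ProjectiveTensor 𝕜 A Aᵐᵒᵖ)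
      = (ContinuousLinearMap.compL 𝕜 A A A).bilinearComp (action 𝕜 A) (action 𝕜 A) := by
    refine hom_ext fun c d => hom_ext fun c' d' => ?_
    ext a
    change action 𝕜 A (_ * _) a = action 𝕜 A _ (action 𝕜 A _ a)
    simp only [tmul_mul_tmul, action_tmul, mul_assoc]
  exact congrArg (fun F : ProjectiveTensor 𝕜 A Aᵐᵒᵖ →L[𝕜] ProjectiveTensor 𝕜 A Aᵐᵒᵖ →L[𝕜] A →L[𝕜] A
    => F b b' a) h

variable (𝕜 A) in
/-- The product map `A ⊗̂ Aᵒᵖ → A`, `a ⊗ b ↦ ab`. -/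
def mulMap : ProjectiveTensor 𝕜 A Aᵐᵒᵖ →L[𝕜] A :=
  ProjectiveTensor.lift ((ContinuousLinearMap.mul 𝕜 A).bilinearComp (.id 𝕜 A) (unopL 𝕜 A))

lemma mulMap_tmul (a b : A) : mulMap 𝕜 A (ProjectiveTensor.tmul 𝕜 A Aᵐᵒᵖ a (op b)) = a * b := by
  rw [mulMap, ProjectiveTensor.lift_tmul]
  rfl

/-- The reversed product in the second factor is what makes this work: on `c ⊗ d` and `c' ⊗ d'` both
sides are `cc'd'd`. -/
lemma mulMap_mul (b x : ProjectiveTensor 𝕜 A Aᵐᵒᵖ) :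
    mulMap 𝕜 A (b * x) = action 𝕜 A b (mulMap 𝕜 A x) := by
  have h : ContinuousLinearMap.compL 𝕜 _ _ _ (mulMap 𝕜 A)
        ∘L ContinuousLinearMap.mul 𝕜 (ProjectiveTensor 𝕜 A Aᵐᵒᵖ)
      = (ContinuousLinearMap.compL 𝕜 _ _ _).flip (mulMap 𝕜 A) ∘L action 𝕜 A := by
    refine hom_ext fun c d => hom_ext fun c' d' => ?_
    change mulMap 𝕜 A (_ * _) = action 𝕜 A _ (mulMap 𝕜 A _)
    simp only [tmul_mul_tmul, action_tmul, mulMap_tmul, mul_assoc]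
  exact congrArg (fun F : ProjectiveTensor 𝕜 A Aᵐᵒᵖ →L[𝕜] ProjectiveTensor 𝕜 A Aᵐᵒᵖ →L[𝕜] A
    => F b x) h

/-! ### The operator bimodule and the splitting of the product map. -/

variable (𝕜 A) in
/-- The operators `A → A ⊗̂ Aᵒᵖ` as a bimodule over `A ⊗̂ Aᵒᵖ`. -/
def operatorBimodule :
    BanachBimodule 𝕜 (ProjectiveTensor 𝕜 A Aᵐᵒᵖ) (A →L[𝕜] ProjectiveTensor 𝕜 A Aᵐᵒᵖ) where
  left := ContinuousLinearMap.compL 𝕜 A _ _ ∘L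
    ContinuousLinearMap.mul 𝕜 (ProjectiveTensor 𝕜 A Aᵐᵒᵖ)
  right := (ContinuousLinearMap.compL 𝕜 A A _).flip ∘L action 𝕜 A
  left_mul b b' T := ContinuousLinearMap.ext fun a => mul_assoc b b' (T a)
  right_mul b b' T := ContinuousLinearMap.ext fun a => congrArg T (action_mul b b' a)
  left_right _ _ _ := rfl

variable (𝕜 A) in
/-- The functional `T ↦ φ (T a)` on the operators `A → A ⊗̂ Aᵒᵖ`. -/
def evalFunctional : A →L[𝕜] StrongDual 𝕜 (ProjectiveTensor 𝕜 A Aᵐᵒᵖ) →L[𝕜]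
    StrongDual 𝕜 (A →L[𝕜] ProjectiveTensor 𝕜 A Aᵐᵒᵖ) :=
  (ContinuousLinearMap.compL 𝕜 (A →L[𝕜] ProjectiveTensor 𝕜 A Aᵐᵒᵖ)
      (ProjectiveTensor 𝕜 A Aᵐᵒᵖ) 𝕜).flip ∘L
    (ContinuousLinearMap.apply 𝕜 (ProjectiveTensor 𝕜 A Aᵐᵒᵖ) :
      A →L[𝕜] (A →L[𝕜] ProjectiveTensor 𝕜 A Aᵐᵒᵖ) →L[𝕜] ProjectiveTensor 𝕜 A Aᵐᵒᵖ)

/-- On these functionals the left action moves only `a` and the right action only `φ`. Centrality of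
a functional on them therefore says that the induced map `A → B**` is a module map. -/
lemma dual_left_evalFunctional (b : ProjectiveTensor 𝕜 A Aᵐᵒᵖ) (a : A)
    (φ : StrongDual 𝕜 (ProjectiveTensor 𝕜 A Aᵐᵒᵖ)) :
    (operatorBimodule 𝕜 A).dual.left b (evalFunctional 𝕜 A a φ)
      = evalFunctional 𝕜 A (action 𝕜 A b a) φ := rfl

lemma dual_right_evalFunctional (b : ProjectiveTensor 𝕜 A Aᵐᵒᵖ) (a : A)
    (φ : StrongDual 𝕜 (ProjectiveTensor 𝕜 A Aᵐᵒᵖ)) :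
    (operatorBimodule 𝕜 A).dual.right b (evalFunctional 𝕜 A a φ)
      = evalFunctional 𝕜 A a (φ ∘L ContinuousLinearMap.mul 𝕜 _ b) := rfl

/-- If `A ⊗̂ Aᵒᵖ` is amenable and `A` has a bounded approximate identity, then the product map
`A ⊗̂ Aᵒᵖ → A` has a right inverse `A → (A ⊗̂ Aᵒᵖ)**` that is a module map over `A ⊗̂ Aᵒᵖ`. -/
theorem exists_module_splitting {𝕜 : Type} [RCLike 𝕜] {A : Type u} [NonUnitalNormedRing A]
    [NormedSpace 𝕜 A] [IsScalarTower 𝕜 A A] [SMulCommClass 𝕜 A A] [CompleteSpace A]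
    (hamen : IsAmenable.{u, u} 𝕜 (ProjectiveTensor 𝕜 A Aᵐᵒᵖ))
    (hbai : HasBoundedApproximateIdentity A) :
    ∃ G : A →L[𝕜] StrongDual 𝕜 (StrongDual 𝕜 (ProjectiveTensor 𝕜 A Aᵐᵒᵖ)),
      (∀ b a φ, G (action 𝕜 A b a) φ = G a (φ ∘L ContinuousLinearMap.mul 𝕜 _ b)) ∧
      ∀ a f, G a (f ∘L mulMap 𝕜 A) = f a := by
  obtain ⟨U, hU, C, hC⟩ := hbai.exists_ultrafilter
  obtain ⟨q, hq⟩ := ContinuousLinearMap.exists_weakStar_limit (𝕜 := 𝕜)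
    (X := StrongDual 𝕜 (A →L[𝕜] ProjectiveTensor 𝕜 A Aᵐᵒᵖ))
    (NormedSpace.inclusionInDoubleDual 𝕜 (A →L[𝕜] ProjectiveTensor 𝕜 A Aᵐᵒᵖ) ∘L
      tensorRight 𝕜 A) hC
  -- `π` sends `a ⊗ e` to `ae`, which tends to `a`: the limit `q` is a right inverse of the product
  -- map.
  have hq_eval : ∀ a f, q (evalFunctional 𝕜 A a (f ∘L mulMap 𝕜 A)) = f a := by
    intro a f
    refine tendsto_nhds_unique (hq _) ?_
    refine ((f.continuous.tendsto a).comp (hU.tendsto_mul_left a)).congr fun e => ?_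
    change f (a * e) = f (mulMap 𝕜 A (tensorRight 𝕜 A e a))
    rw [tensorRight_apply, mulMap_tmul]
  have hmul : ∀ (f : StrongDual 𝕜 A) (b : ProjectiveTensor 𝕜 A Aᵐᵒᵖ),
      (f ∘L mulMap 𝕜 A) ∘L ContinuousLinearMap.mul 𝕜 _ b = (f ∘L action 𝕜 A b) ∘L mulMap 𝕜 A :=
    fun f b => ContinuousLinearMap.ext fun x => congrArg f (mulMap_mul b x)
  have hright : ∀ b a (f : StrongDual 𝕜 A),
      (operatorBimodule 𝕜 A).dual.right b (evalFunctional 𝕜 A a (f ∘L mulMap 𝕜 A))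
        = evalFunctional 𝕜 A a ((f ∘L action 𝕜 A b) ∘L mulMap 𝕜 A) := fun b a f =>
    (dual_right_evalFunctional b a _).trans (congrArg (evalFunctional 𝕜 A a) (hmul f b))
  obtain ⟨p, hpS, hp⟩ := hamen.exists_central_extension (operatorBimodule 𝕜 A).dual
    (Set.range fun x : A × StrongDual 𝕜 A => evalFunctional 𝕜 A x.1 (x.2 ∘L mulMap 𝕜 A))
    (by
      rintro b _ ⟨⟨a, f⟩, rfl⟩
      exact ⟨(action 𝕜 A b a, f), (dual_left_evalFunctional b a _).symm⟩)
    (by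
      rintro b _ ⟨⟨a, f⟩, rfl⟩
      exact ⟨(a, f ∘L action 𝕜 A b), (hright b a f).symm⟩)
    -- Both sides equal `f(b · a)`: `q` is already central where it is tested through the product
    -- map.
    q (by
      rintro b _ ⟨⟨a, f⟩, rfl⟩
      exact (congrArg q (hright b a f)).trans <| (hq_eval a _).trans <|
        (hq_eval (action 𝕜 A b a) f).symm.trans
          (congrArg q (dual_left_evalFunctional b a _)).symm)
  refine ⟨ContinuousLinearMap.compL 𝕜 (StrongDual 𝕜 (ProjectiveTensor 𝕜 A Aᵐᵒᵖ))
    (StrongDual 𝕜 (A →L[𝕜] ProjectiveTensor 𝕜 A Aᵐᵒᵖ)) 𝕜 p ∘L evalFunctional 𝕜 A,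
    fun b a φ => ?_, fun a f => ?_⟩
  · exact (congrArg p (dual_left_evalFunctional b a φ)).symm.trans <|
      (hp b (evalFunctional 𝕜 A a φ)).symm.trans (congrArg p (dual_right_evalFunctional b a φ))
  · exact (hpS _ ⟨(a, f), rfl⟩).trans (hq_eval a f)

/-! ### Consequences of a module splitting: one-sided multiplications and derivations. -/

section Splitting

variable {G : A →L[𝕜] StrongDual 𝕜 (StrongDual 𝕜 (ProjectiveTensor 𝕜 A Aᵐᵒᵖ))}
  {U : Ultrafilter A} {C : ℝ} {φ ψ : StrongDual 𝕜 (ProjectiveTensor 𝕜 A Aᵐᵒᵖ)}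

/-- With a unit this would be the action of `c ⊗ 1`. In its place, `ce ⊗ e` and `e ⊗ e` act on `a`:
the hypothesis makes `φ` after multiplication by the first equal to `ψ` after multiplication by the
second, and `eae → a`. -/
lemma splitting_mul_left
    (hG : ∀ b a φ, G (action 𝕜 A b a) φ = G a (φ ∘L ContinuousLinearMap.mul 𝕜 _ b))
    (hU : (U : Filter A).IsApproximateUnit) (hC : ∀ᶠ e in (U : Filter A), ‖e‖ ≤ C) {c : A}
    (h : ∀ x y, ψ (ProjectiveTensor.tmul 𝕜 A Aᵐᵒᵖ x (op y))
      = φ (ProjectiveTensor.tmul 𝕜 A Aᵐᵒᵖ (c * x) (op y))) (a : A) :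
    G (c * a) φ = G a ψ := by
  have ht := hU.tendsto_mul_mul hC a
  have h1 : Tendsto (fun e => G (c * (e * (a * e))) φ) U (𝓝 (G (c * a) φ)) :=
    (Continuous.tendsto (f := fun z => G (c * z) φ) (by fun_prop) a).comp ht
  have h2 : Tendsto (fun e => G (e * (a * e)) ψ) U (𝓝 (G a ψ)) :=
    (Continuous.tendsto (f := fun z => G z ψ) (by fun_prop) a).comp ht
  refine tendsto_nhds_unique h1 (h2.congr fun e => ?_)
  rw [← mul_assoc c, ← action_tmul (𝕜 := 𝕜), ← action_tmul (𝕜 := 𝕜), hG, hG]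
  congr 1
  refine hom_ext fun x y => ?_
  change ψ (_ * _) = φ (_ * _)
  rw [tmul_mul_tmul, tmul_mul_tmul, h, mul_assoc]

/-- The mirror image, with `e ⊗ ec` standing in for `1 ⊗ c`. -/
lemma splitting_mul_right
    (hG : ∀ b a φ, G (action 𝕜 A b a) φ = G a (φ ∘L ContinuousLinearMap.mul 𝕜 _ b))
    (hU : (U : Filter A).IsApproximateUnit) (hC : ∀ᶠ e in (U : Filter A), ‖e‖ ≤ C) {c : A}
    (h : ∀ x y, ψ (ProjectiveTensor.tmul 𝕜 A Aᵐᵒᵖ x (op y))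
      = φ (ProjectiveTensor.tmul 𝕜 A Aᵐᵒᵖ x (op (y * c)))) (a : A) :
    G (a * c) φ = G a ψ := by
  have ht := hU.tendsto_mul_mul hC a
  have h1 : Tendsto (fun e => G ((e * (a * e)) * c) φ) U (𝓝 (G (a * c) φ)) :=
    (Continuous.tendsto (f := fun z => G (z * c) φ) (by fun_prop) a).comp ht
  have h2 : Tendsto (fun e => G (e * (a * e)) ψ) U (𝓝 (G a ψ)) :=
    (Continuous.tendsto (f := fun z => G z ψ) (by fun_prop) a).comp ht
  refine tendsto_nhds_unique h1 (h2.congr fun e => ?_)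
  rw [mul_assoc e, mul_assoc a, ← action_tmul (𝕜 := 𝕜), ← action_tmul (𝕜 := 𝕜), hG, hG]
  congr 1
  refine hom_ext fun x y => ?_
  change ψ (_ * _) = φ (_ * _)
  rw [tmul_mul_tmul, tmul_mul_tmul, h, mul_assoc]

end Splitting

/-- Given a module splitting of the product map, every derivation into a dual bimodule is inner
up to a weak-star approximation. -/
lemma exists_approximately_inner
    {G : A →L[𝕜] StrongDual 𝕜 (StrongDual 𝕜 (ProjectiveTensor 𝕜 A Aᵐᵒᵖ))}
    (hG : ∀ b a φ, G (action 𝕜 A b a) φ = G a (φ ∘L ContinuousLinearMap.mul 𝕜 _ b))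
    (hGmul : ∀ a f, G a (f ∘L mulMap 𝕜 A) = f a) {U : Ultrafilter A} {C : ℝ}
    (hU : (U : Filter A).IsApproximateUnit) (hC : ∀ᶠ e in (U : Filter A), ‖e‖ ≤ C)
    (M : BanachBimodule 𝕜 A X) {D : A →L[𝕜] StrongDual 𝕜 X} (hD : M.dual.IsDerivation D) :
    ∃ f : StrongDual 𝕜 X, ∀ a x, Tendsto (fun e => D a (M.right e x)) U
      (𝓝 (f (M.right a x) - f (M.left a x))) := by
  set Φ := (derivationMap M D).flip
  have hΦt : ∀ c d x, Φ x (ProjectiveTensor.tmul 𝕜 A Aᵐᵒᵖ c (op d)) = D d (M.right c x) :=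
    fun c d x => derivationMap_tmul M D c d x
  -- `f` is the limit of `G e` carried to `X*` by `c ⊗ d ↦ c · D(d)`.
  obtain ⟨f, hf⟩ := ContinuousLinearMap.exists_weakStar_limit (𝕜 := 𝕜) (X := X)
    ((ContinuousLinearMap.compL 𝕜 X (StrongDual 𝕜 (ProjectiveTensor 𝕜 A Aᵐᵒᵖ)) 𝕜).flip Φ ∘L G) hC
  have hf' : ∀ x, Tendsto (fun e => G e (Φ x)) U (𝓝 (f x)) := hf
  refine ⟨f, fun a x => ?_⟩
  have hr : ∀ e, G (a * e) (Φ x) = G e (Φ (M.right a x)) := by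
    refine splitting_mul_left hG hU hC fun c d => ?_
    rw [hΦt, hΦt, M.right_mul]
  -- By Leibniz, `c · D(da) = cd · D(a) + (c · D(d)) · a`. The first term depends on `c ⊗ d` only
  -- through `cd`, so the splitting property evaluates it at `e`.
  have hl : ∀ e, G (e * a) (Φ x) = G e (Φ (M.left a x)) + D a (M.right e x) := by
    intro e
    have h := hGmul e (D a ∘L M.right.flip x)
    rw [splitting_mul_right hG hU hC (c := a)
      (ψ := Φ (M.left a x) + (D a ∘L M.right.flip x) ∘L mulMap 𝕜 A), map_add, h]
    · rfl
    · intro c d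
      have h1 := congrArg (fun g : StrongDual 𝕜 X => g (M.right c x)) (hD d a)
      change D (d * a) (M.right c x)
        = D a (M.right d (M.right c x)) + D d (M.left a (M.right c x)) at h1
      have h2 : (Φ (M.left a x) + (D a ∘L M.right.flip x) ∘L mulMap 𝕜 A)
            (ProjectiveTensor.tmul 𝕜 A Aᵐᵒᵖ c (op d))
          = D d (M.right c (M.left a x)) + D a (M.right (c * d) x) := by
        rw [← hΦt, ← mulMap_tmul (𝕜 := 𝕜)]
        rfl
      rw [h2, hΦt, h1, M.right_mul, M.left_right, add_comm]
  -- Both `ae` and `ea` tend to `a`, so `G e` asymptotically commutes with `a`.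
  have hcomm : Tendsto (fun e => G (a * e) (Φ x) - G (e * a) (Φ x)) U (𝓝 0) := by
    have hc : Continuous fun z => G z (Φ x) := by fun_prop
    simpa using ((hc.tendsto a).comp (hU.tendsto_mul_left a)).sub
      ((hc.tendsto a).comp (hU.tendsto_mul_right a))
  have := ((hf' (M.right a x)).sub (hf' (M.left a x))).sub hcomm
  rw [sub_zero] at this
  refine this.congr fun e => ?_
  rw [hr, hl]
  ring

end Enveloping

/-! ### Removing the part of a derivation killed by the left action. -/

/-- If a derivation into a dual bimodule is inner up to a weak-star approximation along a bounded
approximate identity, then it is inner. -/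
lemma BanachBimodule.isInner_of_tendsto {𝕜 A X : Type*} [RCLike 𝕜] [NonUnitalNormedRing A]
    [NormedSpace 𝕜 A] [NormedAddCommGroup X] [NormedSpace 𝕜 X] (M : BanachBimodule 𝕜 A X)
    {D : A →L[𝕜] StrongDual 𝕜 X} (hD : M.dual.IsDerivation D) {U : Ultrafilter A} {C : ℝ}
    (hU : (U : Filter A).IsApproximateUnit) (hC : ∀ᶠ e in (U : Filter A), ‖e‖ ≤ C)
    {f : StrongDual 𝕜 X} (hf : ∀ a x, Tendsto (fun e => D a (M.right e x)) U
      (𝓝 (f (M.right a x) - f (M.left a x)))) : M.dual.IsInner D := by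
  let D' : A →L[𝕜] StrongDual 𝕜 X := D - (M.dual.left.flip f - M.dual.right.flip f)
  have hD'_apply : ∀ a x, D' a x = D a x - (f (M.right a x) - f (M.left a x)) := fun _ _ => rfl
  -- That is, `b · D'(a) = 0`: on vectors `x · b` the approximation becomes exact, since `be → b`.
  have hD'_right : ∀ a b x, D' a (M.right b x) = 0 := by
    intro a b x
    rw [hD'_apply, sub_eq_zero]
    refine tendsto_nhds_unique ?_ (hf a (M.right b x))
    have hc : Continuous fun z => D a (M.right z x) := by fun_prop
    refine ((hc.tendsto b).comp (hU.tendsto_mul_left b)).congr fun e => ?_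
    exact congrArg (D a) (M.right_mul b e x)
  have hD'_mul : ∀ a b x, D' (a * b) x = D' a (M.left b x) := by
    intro a b x
    have h := congrArg (fun g : StrongDual 𝕜 X => g x) (hD a b)
    change D (a * b) x = D b (M.right a x) + D a (M.left b x) at h
    have h0 := hD'_right b a x
    rw [hD'_apply] at h0 ⊢
    rw [hD'_apply, h, M.right_mul, M.left_mul]
    have h1 := M.left_right b a x
    rw [h1]
    linear_combination h0
  -- Now `D'(ea) = D'(e) · a`, so the limit `g` of `D'(e)` satisfies `g · a = D'(a)` and `a · g =
  -- 0`. Hence `-g` implements `D'`.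
  obtain ⟨g, hg⟩ := D'.exists_weakStar_limit hC
  have hg_left : ∀ a x, g (M.left a x) = D' a x := by
    intro a x
    refine tendsto_nhds_unique (hg _) ?_
    have hc : Continuous fun z => D' z x := by fun_prop
    exact ((hc.tendsto a).comp (hU.tendsto_mul_right a)).congr fun e => hD'_mul e a x
  have hg_right : ∀ a x, g (M.right a x) = 0 := fun a x =>
    tendsto_nhds_unique (hg _) (by simp only [hD'_right, tendsto_const_nhds])
  refine ⟨f - g, fun a => ContinuousLinearMap.ext fun x => ?_⟩
  change D a x = (f (M.right a x) - g (M.right a x)) - (f (M.left a x) - g (M.left a x))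
  rw [hg_left, hg_right, hD'_apply]
  ring

end

theorem theorem2p3 {𝕜 : Type} [RCLike 𝕜] {A : Type u} [NonUnitalNormedRing A] [NormedSpace 𝕜 A]
    [IsScalarTower 𝕜 A A] [SMulCommClass 𝕜 A A] [CompleteSpace A]
    (hamen : IsAmenable.{u, u} 𝕜 (ProjectiveTensor 𝕜 A Aᵐᵒᵖ))
    (hbai : HasBoundedApproximateIdentity A) :
    IsAmenable.{u, v} 𝕜 A := by
  obtain ⟨G, hG, hGmul⟩ := Enveloping.exists_module_splitting hamen hbai
  -- This ultrafilter need not be the one behind `G`, since only the two identities for `G` are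
  -- used. Amenability of the enveloping algebra has been spent on a bimodule built from `A` alone,
  -- so `X` may live in any universe.
  obtain ⟨U, hU, C, hC⟩ := hbai.exists_ultrafilter
  intro X _ _ _ M D hD
  obtain ⟨f, hf⟩ := Enveloping.exists_approximately_inner hG hGmul hU hC M hD
  exact M.isInner_of_tendsto hD hU hC hf
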